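/- Let $N\ge 1$ be an odd integer and let $U_n$ denote the Chebyshev polynomial of the second kind, $U_n(\cos t)=\sin((n+1)t)/\sin t$. Consider the problem $$\hat J_N=\max\Big\{\sum_{j=1}^N\alpha_j \;:\; \alpha_1,\dots,\alpha_N\in\mathbb R,\ \alpha_1=1,\ \sum_{j=1}^N\alpha_j\sin jt\ge 0 \text{ for all } t\in[0,\pi]\Big\},$$ and call $\sum_{j=1}^N\alpha_j z^j$ an extremal polynomial if $(\alpha_1,\dots,\alpha_N)$ satisfies the constraints and attains the maximum. Put $\mu=\sin\frac{\pi}{2(N+2)}$. Then $U_N'(\mu)\neq 0$, and there is exactly one extremal polynomial; its coefficients are $$\alpha_k=\frac{(-1)^{k-1}\,U'_{N-k+1}(\mu)\,U_{k-1}(\mu)}{U'_N(\mu)},\qquad k=1,\dots,N.$$ Moreover, $\alpha_k>0$ for all $k=1,\dots,N$. -/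

import Mathlib

/-- The sine polynomial `∑_{j=1}^N α_j sin (j t)`. Only the entries `α 1, …, α N` are used. -/
noncomputable def sinePoly (N : ℕ) (α : ℕ → ℝ) (t : ℝ) : ℝ :=
  ∑ j ∈ Finset.Icc 1 N, α j * Real.sin ((j : ℝ) * t)

/-- Coefficient sequences of the normalized sine polynomials of degree at most `N` that are
nonnegative on `[0, π]`. -/
def admissibleCoeffs (N : ℕ) : Set (ℕ → ℝ) :=
  {α | α 1 = 1 ∧ ∀ t ∈ Set.Icc (0 : ℝ) Real.pi, 0 ≤ sinePoly N α t}

/-- `α_1, …, α_N` are the coefficients of an extremal polynomial `∑_{j=1}^N α_j z^j` of the problem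
of maximizing `∑_{j=1}^N α_j` over all admissible coefficients. -/
def IsExtremalCoeffs (N : ℕ) (α : ℕ → ℝ) : Prop :=
  α ∈ admissibleCoeffs N ∧
    IsMaxOn (fun β : ℕ → ℝ => ∑ j ∈ Finset.Icc 1 N, β j) (admissibleCoeffs N) α

/-- `(-1)^(k-1) U'_{N-k+1}(μ) U_{k-1}(μ) / U'_N(μ)` with `μ = sin (π / (2 (N + 2)))`; the indices of
the Chebyshev polynomials of the second kind are integers. -/
noncomputable def explicitCoeff (N k : ℕ) : ℝ :=
  (-1) ^ (k - 1) *
      (Polynomial.derivative (Polynomial.Chebyshev.U ℝ ((N : ℤ) - k + 1))).eval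
        (Real.sin (Real.pi / (2 * ((N : ℝ) + 2)))) *
      (Polynomial.Chebyshev.U ℝ ((k : ℤ) - 1)).eval
        (Real.sin (Real.pi / (2 * ((N : ℝ) + 2)))) /
    (Polynomial.derivative (Polynomial.Chebyshev.U ℝ (N : ℤ))).eval
      (Real.sin (Real.pi / (2 * ((N : ℝ) + 2))))

/-! Write `N = 2m+1`, `M = N+2`, and let `t_i` be the odd multiples of `π/M` in `(0, 2π)`. For a
sine polynomial `S` of degree at most `N`, discrete orthogonality gives `∑ cot(t_i/2) S(t_i) = M ∑
α_j` and `∑ sin(t_i) S(t_i) = (M/2) α_1`. A combination of the two with zero weight at `t_0`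
expresses the defect `E - ∑ α_j` through values of `S` with positive weights at `t_1, …, t_m`
(`sum_defectWeight_mul_sinePoly`). Hence `E` is an upper bound, attained exactly when `S` vanishes
at these nodes (`sum_coeff_eq_iff`). Such an `S` exists: normalize `sin t ∏ (cos t - cos t_i)^2`
(`exists_admissible_vanishing`). It is unique: nonnegativity makes the zeros double, and node sums
of `S` and `S'` then determine every `α_k` (`coeff_eq_of_vanishing`). The closed form so obtained is
the Chebyshev expression (`explicitCoeff_eq`). -/

open Finset Real

/-! ### Discrete orthogonality at the nodes. -/

/-- The odd multiples of `π / M`. -/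
noncomputable def oddNode (M i : ℕ) : ℝ := (2 * (i : ℝ) + 1) * π / M

theorem sum_cos_oddNode {M : ℕ} (hM : 0 < M) {k : ℤ} (hk : ¬ (M : ℤ) ∣ k) :
    ∑ i ∈ range M, cos (k * oddNode M i) = 0 := by
  have hM' : (M : ℝ) ≠ 0 := by positivity
  have hs : sin (k * (π / M)) ≠ 0 := by
    intro h
    obtain ⟨n, hn⟩ := Real.sin_eq_zero_iff.1 h
    apply hk
    have : (k : ℝ) = M * n := by
      field_simp at hn
      linarith
    exact ⟨n, by exact_mod_cast this⟩
  -- Multiplying by `2 sin(kπ/M)` makes the sum telescope.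
  have key : (∑ i ∈ range M, cos (k * oddNode M i)) * (2 * sin (k * (π / M))) = 0 := by
    rw [Finset.sum_mul]
    have : ∀ i ∈ range M, cos (k * oddNode M i) * (2 * sin (k * (π / M)))
        = sin (2 * k * (π / M) * ((i + 1 : ℕ) : ℝ)) - sin (2 * k * (π / M) * (i : ℝ)) := by
      intro i _
      have h1 : 2 * k * (π / M) * ((i + 1 : ℕ) : ℝ) = k * oddNode M i + k * (π / M) := by
        simp only [oddNode]; push_cast; ring
      have h2 : 2 * k * (π / M) * (i : ℝ) = k * oddNode M i - k * (π / M) := by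
        simp only [oddNode]; ring
      rw [h1, h2, sin_add, sin_sub]; ring
    rw [Finset.sum_congr rfl this,
      Finset.sum_range_sub (fun i : ℕ => sin (2 * k * (π / M) * (i : ℝ)))]
    have h3 : 2 * k * (π / M) * (M : ℝ) = ((2 * k : ℤ) : ℝ) * π := by
      push_cast; field_simp
    rw [h3, sin_int_mul_pi]; simp
  exact (mul_eq_zero.1 key).resolve_right (mul_ne_zero two_ne_zero hs)

theorem sum_cos_self_mul_oddNode {M : ℕ} (hM : 0 < M) :
    ∑ i ∈ range M, cos (M * oddNode M i) = -M := by
  have hM' : (M : ℝ) ≠ 0 := by positivity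
  have : ∀ i ∈ range M, cos (M * oddNode M i) = -1 := by
    intro i _
    have : (M : ℝ) * oddNode M i = π + i * (2 * π) := by
      simp only [oddNode]; field_simp; ring
    rw [this, cos_add_nat_mul_two_pi, cos_pi]
  rw [Finset.sum_congr rfl this]; simp

theorem sum_cos_sub_oddNode {M j k : ℕ} (hj : j < M) (hk : k < M) :
    ∑ i ∈ range M, cos (((j : ℝ) - k) * oddNode M i) = if j = k then (M : ℝ) else 0 := by
  split_ifs with h
  · simp [h]
  · have := sum_cos_oddNode (M := M) (by omega) (k := (j : ℤ) - k) (by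
      intro hd
      have := Int.eq_zero_of_abs_lt_dvd hd (by rw [abs_lt]; constructor <;> omega)
      omega)
    exact_mod_cast this

theorem sum_cos_add_oddNode {M j k : ℕ} (hj0 : 0 < j) (hj : j < M) (hk : k < M) :
    ∑ i ∈ range M, cos (((j : ℝ) + k) * oddNode M i) = if j + k = M then -(M : ℝ) else 0 := by
  split_ifs with h
  · have := sum_cos_self_mul_oddNode (M := M) (by omega)
    rw [← this, ← h]; push_cast; rfl
  · have := sum_cos_oddNode (M := M) (by omega) (k := (j : ℤ) + k) (by
      intro hd
      have := Int.eq_zero_of_abs_lt_dvd (x := (j : ℤ) + k - M) (m := M) (dvd_sub_self_right.2 hd)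
        (by rw [abs_lt]; constructor <;> omega)
      omega)
    exact_mod_cast this

/-- Since `M t_i` is an odd multiple of `π`, frequencies `k` and `M - k` alias at the nodes: the
sines agree, while the cosines differ in sign. This accounts for the second indicator here and its
opposite sign for cosines. -/
theorem sum_sin_mul_sin_oddNode {M j k : ℕ} (hj0 : 0 < j) (hj : j < M) (hk : k < M) :
    ∑ i ∈ range M, sin (j * oddNode M i) * sin (k * oddNode M i)
      = M / 2 * ((if j = k then 1 else 0) + if j + k = M then 1 else 0) := by
  have h : ∀ i ∈ range M, sin (j * oddNode M i) * sin (k * oddNode M i)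
      = (cos (((j : ℝ) - k) * oddNode M i) - cos (((j : ℝ) + k) * oddNode M i)) / 2 := by
    intro i _
    rw [sub_mul, add_mul, cos_sub, cos_add]; ring
  rw [Finset.sum_congr rfl h, ← Finset.sum_div, Finset.sum_sub_distrib,
    sum_cos_sub_oddNode hj hk, sum_cos_add_oddNode hj0 hj hk]
  split_ifs <;> ring

theorem sum_cos_mul_cos_oddNode {M j k : ℕ} (hj0 : 0 < j) (hj : j < M) (hk : k < M) :
    ∑ i ∈ range M, cos (j * oddNode M i) * cos (k * oddNode M i)
      = M / 2 * ((if j = k then 1 else 0) - if j + k = M then 1 else 0) := by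
  have h : ∀ i ∈ range M, cos (j * oddNode M i) * cos (k * oddNode M i)
      = (cos (((j : ℝ) - k) * oddNode M i) + cos (((j : ℝ) + k) * oddNode M i)) / 2 := by
    intro i _
    rw [sub_mul, add_mul, cos_sub, cos_add]; ring
  rw [Finset.sum_congr rfl h, ← Finset.sum_div, Finset.sum_add_distrib,
    sum_cos_sub_oddNode hj hk, sum_cos_add_oddNode hj0 hj hk]
  split_ifs <;> ring

/-! ### Position and symmetry of the nodes; the cotangent sum. -/

theorem oddNode_pos {M : ℕ} (hM : 0 < M) (i : ℕ) : 0 < oddNode M i := by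
  have := pi_pos
  unfold oddNode; positivity

theorem oddNode_strictMono {M : ℕ} (hM : 0 < M) : StrictMono (oddNode M) := by
  intro i j h
  have : (i : ℝ) < j := by exact_mod_cast h
  have := pi_pos
  unfold oddNode
  gcongr

theorem oddNode_reflect {M i : ℕ} (hi : i < M) :
    oddNode M (M - 1 - i) = 2 * π - oddNode M i := by
  have hM : (M : ℝ) ≠ 0 := by have : 0 < M := by omega
                              positivity
  have : ((M - 1 - i : ℕ) : ℝ) = M - 1 - i := by
    rw [Nat.cast_sub (by omega), Nat.cast_sub (by omega)]; simp
  unfold oddNode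
  rw [this]; field_simp; ring

theorem oddNode_lt_two_pi {M i : ℕ} (hi : i < M) : oddNode M i < 2 * π := by
  have h := oddNode_pos (M := M) (by omega) (M - 1 - i)
  rw [oddNode_reflect hi] at h
  linarith

theorem oddNode_middle (m : ℕ) : oddNode (2 * m + 3) (m + 1) = π := by
  unfold oddNode; push_cast; field_simp; ring

theorem sin_half_oddNode_pos {M i : ℕ} (hi : i < M) : 0 < sin (oddNode M i / 2) := by
  apply sin_pos_of_pos_of_lt_pi
  · have := oddNode_pos (M := M) (by omega) i
    linarith
  · have := oddNode_lt_two_pi hi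
    linarith

/-- Induction on `j` through `cot(t/2) (sin((l+1)t) - sin(lt)) = cos((l+1)t) + cos(lt)`. The cosine
sums vanish except at frequency `0`, which contributes `M`. -/
theorem sum_cot_mul_sin_oddNode {M j : ℕ} (hj0 : 0 < j) (hj : j < M) :
    ∑ i ∈ range M, cos (oddNode M i / 2) / sin (oddNode M i / 2) * sin (j * oddNode M i) = M := by
  have hstep : ∀ l : ℕ, ∑ i ∈ range M, cos (oddNode M i / 2) / sin (oddNode M i / 2)
        * sin ((l + 1 : ℕ) * oddNode M i)
      = ∑ i ∈ range M, cos (oddNode M i / 2) / sin (oddNode M i / 2) * sin (l * oddNode M i)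
        + (∑ i ∈ range M, cos (((l + 1 : ℕ) : ℤ) * oddNode M i)
          + ∑ i ∈ range M, cos ((l : ℤ) * oddNode M i)) := by
    intro l
    rw [← Finset.sum_add_distrib, ← Finset.sum_add_distrib]
    refine Finset.sum_congr rfl fun i hi => ?_
    have hs := (sin_half_oddNode_pos (Finset.mem_range.1 hi)).ne'
    generalize oddNode M i = t at hs ⊢
    have e1 : ((l + 1 : ℕ) : ℝ) * t = l * t + 2 * (t / 2) := by push_cast; ring
    have e2 : (((l + 1 : ℕ) : ℤ) : ℝ) * t = l * t + 2 * (t / 2) := by push_cast; ring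
    rw [e1, e2, Int.cast_natCast, sin_add, cos_add, sin_two_mul, cos_two_mul]
    generalize (l : ℝ) * t = a
    field_simp
    linear_combination (2 * sin a * cos (t / 2)) * sin_sq_add_cos_sq (t / 2)
  have hnd : ∀ l : ℕ, 0 < l → l < M → ¬ (M : ℤ) ∣ (l : ℤ) := by
    intro l h0 h1 hd
    have := Nat.le_of_dvd h0 (by exact_mod_cast hd)
    omega
  induction j, hj0 using Nat.le_induction with
  | base =>
    have := hstep 0
    rw [sum_cos_oddNode (by omega) (hnd (0 + 1) (by omega) (by omega))] at this
    simpa using this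
  | succ l hl ih =>
    rw [hstep l, ih (by omega), sum_cos_oddNode (by omega) (hnd (l + 1) (by omega) (by omega)),
      sum_cos_oddNode (by omega) (hnd l (by omega) (by omega))]
    ring

/-! ### The Chebyshev expression in trigonometric form, and its positivity. -/

theorem sin_cubed_mul_derivative_U_cos (n : ℤ) (φ : ℝ) :
    sin φ ^ 3 * (Polynomial.derivative (Polynomial.Chebyshev.U ℝ n)).eval (cos φ)
      = cos φ * sin ((n + 1) * φ) - sin φ * ((n + 1) * cos ((n + 1) * φ)) := by
  have h := congrArg (Polynomial.eval (cos φ))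
    (Polynomial.Chebyshev.add_one_mul_T_eq_poly_in_U (R := ℝ) n)
  simp only [Polynomial.eval_mul, Polynomial.eval_add, Polynomial.eval_sub, Polynomial.eval_X,
    Polynomial.eval_pow, Polynomial.eval_one, Polynomial.eval_intCast,
    Polynomial.Chebyshev.T_real_cos] at h
  have hU := Polynomial.Chebyshev.U_real_cos φ n
  push_cast at h
  have h2 := sin_sq_add_cos_sq φ
  rw [← hU]
  linear_combination sin φ * h
    + sin φ * (Polynomial.derivative (Polynomial.Chebyshev.U ℝ n)).eval (cos φ) * h2

/-- The angle in question is `(M - k)φ = (m+1)π - kφ`, so everything reduces to frequency `k`. -/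
theorem derivative_U_eval_critical {m : ℕ} {φ : ℝ} (hφ : (2 * (m : ℝ) + 3) * φ = (m + 1) * π)
    (k : ℕ) :
    sin φ ^ 3 * (Polynomial.derivative
        (Polynomial.Chebyshev.U ℝ (((2 * m + 1 : ℕ) : ℤ) - k + 1))).eval (cos φ)
      = (-1) ^ m * (cos φ * sin (k * φ) + sin φ * ((2 * m + 3 - k) * cos (k * φ))) := by
  rw [sin_cubed_mul_derivative_U_cos]
  have h : (((((2 * m + 1 : ℕ) : ℤ) - k + 1 : ℤ) : ℝ) + 1) * φ = ((m + 1 : ℕ) : ℝ) * π - k * φ := by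
    push_cast; linear_combination hφ
  rw [h, sin_sub, cos_sub, sin_nat_mul_pi, cos_nat_mul_pi]
  push_cast
  ring

theorem exists_critical_angle (m : ℕ) :
    ∃ φ : ℝ, (2 * (m : ℝ) + 3) * φ = (m + 1) * π ∧ 0 < sin φ ∧ 0 < cos φ ∧
      oddNode (2 * m + 3) 0 = π - 2 * φ ∧
      sin (π / (2 * (((2 * m + 1 : ℕ) : ℝ) + 2))) = cos φ := by
  have hpi := pi_pos
  have h3 : (0 : ℝ) < 2 * m + 3 := by positivity
  have hθ : 0 < π / (2 * (2 * (m : ℝ) + 3)) := by positivity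
  have hθ2 : π / (2 * (2 * (m : ℝ) + 3)) < π / 2 := by
    apply div_lt_div_of_pos_left hpi (by norm_num)
    linarith [(Nat.cast_nonneg m : (0 : ℝ) ≤ m)]
  -- The complement of `π/(2M)`, so that `μ = cos φ`.
  refine ⟨π / 2 - π / (2 * (2 * m + 3)), ?_, ?_, ?_, ?_, ?_⟩
  · field_simp; ring
  · exact sin_pos_of_pos_of_lt_pi (by linarith) (by linarith)
  · exact cos_pos_of_mem_Ioo ⟨by linarith, by linarith⟩
  · unfold oddNode; push_cast; field_simp; ring
  · rw [cos_pi_div_two_sub]; push_cast; congr 3; ring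

theorem derivative_U_eval_cos_critical {m : ℕ} {φ : ℝ}
    (hφ : (2 * (m : ℝ) + 3) * φ = (m + 1) * π) (hs : sin φ ≠ 0) :
    sin φ ^ 2 * (Polynomial.derivative
        (Polynomial.Chebyshev.U ℝ ((2 * m + 1 : ℕ) : ℤ))).eval (cos φ)
      = (-1) ^ m * ((2 * m + 3) * cos φ) := by
  have h := derivative_U_eval_critical hφ 1
  rw [show ((2 * m + 1 : ℕ) : ℤ) - (1 : ℕ) + 1 = ((2 * m + 1 : ℕ) : ℤ) by push_cast; ring] at h
  apply mul_left_cancel₀ hs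
  rw [Nat.cast_one, one_mul] at h
  linear_combination h

theorem derivative_U_eval_sin_ne_zero (m : ℕ) :
    (Polynomial.derivative (Polynomial.Chebyshev.U ℝ ((2 * m + 1 : ℕ) : ℤ))).eval
      (sin (π / (2 * (((2 * m + 1 : ℕ) : ℝ) + 2)))) ≠ 0 := by
  obtain ⟨φ, hφ, hs, hc, -, hx⟩ := exists_critical_angle m
  rw [hx]
  intro h0
  have h := derivative_U_eval_cos_critical hφ hs.ne'
  rw [h0, mul_zero] at h
  have h3 : (2 * (m : ℝ) + 3) ≠ 0 := by positivity
  exact mul_ne_zero (pow_ne_zero m (by norm_num)) (mul_ne_zero h3 hc.ne') h.symm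

/-- The right-hand side is the form in which the node sums deliver `M α_k` in
`coeff_eq_of_vanishing`. -/
theorem explicitCoeff_eq (m k : ℕ) (hk : 1 ≤ k) :
    (2 * (m : ℝ) + 3) * explicitCoeff (2 * m + 1) k
      = (2 * m + 3 - k) * sin (k * oddNode (2 * m + 3) 0) / sin (oddNode (2 * m + 3) 0)
        + (cos (k * oddNode (2 * m + 3) 0) - (-1) ^ k) / (1 + cos (oddNode (2 * m + 3) 0)) := by
  have hne := derivative_U_eval_sin_ne_zero m
  obtain ⟨φ, hφ, hs, hc, hd, hx⟩ := exists_critical_angle m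
  unfold explicitCoeff
  rw [hx] at hne ⊢
  have hN := derivative_U_eval_cos_critical hφ hs.ne'
  have hV := derivative_U_eval_critical hφ k
  have hU := Polynomial.Chebyshev.U_real_cos φ ((k : ℤ) - 1)
  push_cast at hU
  rw [sub_add_cancel] at hU
  have hM : (2 * (m : ℝ) + 3) ≠ 0 := by positivity
  have hε : ((-1 : ℝ) ^ m) * (-1) ^ m = 1 := by rw [← mul_pow]; norm_num
  have hη : ((-1 : ℝ) ^ k) * (-1) ^ k = 1 := by rw [← mul_pow]; norm_num
  have hη' : (-1 : ℝ) ^ (k - 1) = -(-1) ^ k := by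
    obtain ⟨l, rfl⟩ := Nat.exists_eq_add_of_le' hk
    simp [pow_succ]
  have ed : (k : ℝ) * (π - 2 * φ) = k * π - 2 * (k * φ) := by ring
  rw [hd, ed, hη', sin_sub, cos_sub, sin_pi_sub, cos_pi_sub, sin_nat_mul_pi, cos_nat_mul_pi,
    sin_two_mul, cos_two_mul, sin_two_mul, cos_two_mul]
  generalize Polynomial.eval _ (Polynomial.derivative
    (Polynomial.Chebyshev.U ℝ ((2 * m + 1 : ℕ) : ℤ))) = VN at *
  generalize Polynomial.eval _ (Polynomial.derivative
    (Polynomial.Chebyshev.U ℝ (((2 * m + 1 : ℕ) : ℤ) - k + 1))) = V at *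
  generalize Polynomial.eval _ (Polynomial.Chebyshev.U ℝ ((k : ℤ) - 1)) = W at *
  have hVN : VN = (-1) ^ m * ((2 * m + 3) * cos φ) / sin φ ^ 2 := by
    rw [← hN]; field_simp
  have hV' : V = (-1) ^ m * (cos φ * sin (k * φ) + sin φ * ((2 * m + 3 - k) * cos (k * φ)))
      / sin φ ^ 3 := by
    rw [← hV]; field_simp
  have hW : W = sin (k * φ) / sin φ := by rw [← hU]; field_simp
  have hm0 : (-1 : ℝ) ^ m ≠ 0 := pow_ne_zero m (by norm_num)
  have hq : 1 + -(2 * cos φ ^ 2 - 1) = 2 * sin φ ^ 2 := by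
    linarith [sin_sq_add_cos_sq φ]
  have hr : cos (k * φ) ^ 2 = 1 - sin (k * φ) ^ 2 := by linarith [sin_sq_add_cos_sq (k * φ)]
  rw [hq, hr, hVN, hV', hW]
  generalize (k : ℝ) * φ = a
  field_simp
  ring

theorem explicitCoeff_pos (m k : ℕ) (hk : k ∈ Icc 1 (2 * m + 1)) :
    0 < explicitCoeff (2 * m + 1) k := by
  obtain ⟨h1, h2⟩ := Finset.mem_Icc.1 hk
  set θ : ℝ := π / (2 * (2 * m + 3)) with hθ
  have hM : (0 : ℝ) < 2 * m + 3 := by positivity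
  have hpi := pi_pos
  have hd : oddNode (2 * m + 3) 0 = 2 * θ := by
    rw [hθ]; unfold oddNode; push_cast; field_simp; ring
  have hθ0 : 0 < θ := by positivity
  have hθM : (2 * (m : ℝ) + 3) * θ = π / 2 := by rw [hθ]; field_simp
  have h2' : (k : ℝ) ≤ 2 * m + 1 := by exact_mod_cast h2
  have h1' : (1 : ℝ) ≤ k := by exact_mod_cast h1
  have hθ3 : θ < π / 3 := by
    have : (0 : ℝ) ≤ m := by positivity
    nlinarith [mul_nonneg this hθ0.le]
  have hc : 1 / 2 < cos θ := by
    rw [← cos_pi_div_three]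
    exact cos_lt_cos_of_nonneg_of_le_pi_div_two hθ0.le (by linarith) hθ3
  have hs : 0 < sin θ := sin_pos_of_pos_of_lt_pi hθ0 (by linarith)
  have hkθ : (k : ℝ) * θ < π / 2 := by rw [← hθM]; gcongr; linarith
  have hsk : 0 < sin (k * θ) := sin_pos_of_pos_of_lt_pi (by positivity) (by linarith)
  have hck : sin θ ≤ cos (k * θ) := by
    rw [← sin_pi_div_two_sub, ← hθM]
    apply sin_le_sin_of_le_of_le_pi_div_two
    · linarith
    · rw [hθM]; nlinarith
    · nlinarith
  -- Uses `M - k ≥ 2`, `cos θ > 1/2`, and `cos(kθ) ≥ sin θ`, the last because `kθ ≤ π/2 - θ`.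
  have key : sin θ * sin (k * θ) < (2 * m + 3 - k) * (cos (k * θ) * cos θ) := by
    calc sin θ * sin (k * θ) ≤ sin θ := by nlinarith [sin_le_one (k * θ)]
      _ < 2 * (sin θ * cos θ) := by nlinarith
      _ ≤ 2 * (cos (k * θ) * cos θ) := by gcongr
      _ ≤ _ := by
        have : 0 ≤ cos (k * θ) * cos θ := mul_nonneg (hs.le.trans hck) (by linarith)
        gcongr; linarith
  have hpos : 0 < (2 * (m : ℝ) + 3) * explicitCoeff (2 * m + 1) k := by
    rw [explicitCoeff_eq m k h1, hd, mul_left_comm, sin_two_mul, sin_two_mul, cos_two_mul,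
      cos_two_mul]
    have e : (2 * (m : ℝ) + 3 - k) * (2 * sin (k * θ) * cos (k * θ)) / (2 * sin θ * cos θ)
        + (2 * cos (k * θ) ^ 2 - 1 - (-1) ^ k) / (1 + (2 * cos θ ^ 2 - 1))
        = (2 * sin (k * θ) * ((2 * m + 3 - k) * (cos (k * θ) * cos θ) - sin θ * sin (k * θ))
          + sin θ * (1 - (-1) ^ k)) / (2 * sin θ * cos θ ^ 2) := by
      have : cos θ ≠ 0 := by linarith
      have h3 : cos (k * θ) ^ 2 = 1 - sin (k * θ) ^ 2 := by
        linarith [sin_sq_add_cos_sq (k * θ)]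
      rw [h3, show 1 + (2 * cos θ ^ 2 - 1) = 2 * cos θ ^ 2 by ring]
      field_simp
      ring
    rw [e]
    have h4 : (-1 : ℝ) ^ k ≤ 1 := by
      rcases neg_one_pow_eq_or ℝ k with h | h <;> norm_num [h]
    have h5 : 0 < cos θ := by linarith
    apply div_pos _ (by positivity)
    have := mul_pos hsk (sub_pos.2 key)
    have := mul_nonneg hs.le (sub_nonneg.2 h4)
    linarith
  exact pos_of_mul_pos_right hpos hM.le

/-! ### Recovering the coefficients from double zeros at the nodes. -/

/-- The derivative of `sinePoly N α`. -/
noncomputable def sinePolyDeriv (N : ℕ) (α : ℕ → ℝ) (t : ℝ) : ℝ :=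
  ∑ j ∈ Icc 1 N, α j * (j * cos ((j : ℝ) * t))

theorem hasDerivAt_sinePoly (N : ℕ) (α : ℕ → ℝ) (t : ℝ) :
    HasDerivAt (sinePoly N α) (sinePolyDeriv N α t) t := by
  unfold sinePolyDeriv
  have : sinePoly N α = fun t => ∑ j ∈ Icc 1 N, α j * sin ((j : ℝ) * t) := rfl
  rw [this]
  refine HasDerivAt.fun_sum fun j _ => HasDerivAt.const_mul _ ?_
  have := ((hasDerivAt_id t).const_mul (j : ℝ)).sin
  simpa [mul_comm] using this

theorem sinePoly_reflect (N : ℕ) (α : ℕ → ℝ) (t : ℝ) :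
    sinePoly N α (2 * π - t) = -sinePoly N α t := by
  unfold sinePoly
  rw [← Finset.sum_neg_distrib]
  refine Finset.sum_congr rfl fun j _ => ?_
  rw [show (j : ℝ) * (2 * π - t) = j * (2 * π) - j * t by ring, sin_nat_mul_two_pi_sub]
  ring

theorem sinePolyDeriv_reflect (N : ℕ) (α : ℕ → ℝ) (t : ℝ) :
    sinePolyDeriv N α (2 * π - t) = sinePolyDeriv N α t := by
  unfold sinePolyDeriv
  refine Finset.sum_congr rfl fun j _ => ?_
  rw [show (j : ℝ) * (2 * π - t) = j * (2 * π) - j * t by ring, cos_nat_mul_two_pi_sub]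

theorem sinePoly_pi (N : ℕ) (α : ℕ → ℝ) : sinePoly N α π = 0 := by
  simp [sinePoly, sin_nat_mul_pi]

/-- The inner sum is the aliased coefficient `α_{N+2-k}`, or `0` when that index exceeds `N`. -/
theorem sum_sinePoly_mul_sin {N k : ℕ} (α : ℕ → ℝ) (hk : k ∈ Icc 1 N) :
    ∑ i ∈ range (N + 2), sinePoly N α (oddNode (N + 2) i) * sin (k * oddNode (N + 2) i)
      = ((N : ℝ) + 2) / 2 * (α k + ∑ j ∈ Icc 1 N, if j + k = N + 2 then α j else 0) := by
  have hk' := Finset.mem_Icc.1 hk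
  simp_rw [sinePoly, Finset.sum_mul]
  rw [Finset.sum_comm]
  have : ∀ j ∈ Icc 1 N, ∑ i ∈ range (N + 2),
      α j * sin (j * oddNode (N + 2) i) * sin (k * oddNode (N + 2) i)
      = ((N : ℝ) + 2) / 2 * ((if j = k then α j else 0) + if j + k = N + 2 then α j else 0) := by
    intro j hj
    have hj' := Finset.mem_Icc.1 hj
    simp_rw [mul_assoc]
    rw [← Finset.mul_sum, sum_sin_mul_sin_oddNode (by omega) (by omega) (by omega)]
    push_cast
    split_ifs <;> ring
  rw [Finset.sum_congr rfl this, ← Finset.mul_sum, Finset.sum_add_distrib,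
    Finset.sum_ite_eq' (Icc 1 N) k, if_pos hk]

theorem sum_sinePolyDeriv_mul_cos {N k : ℕ} (α : ℕ → ℝ) (hk : k ≤ N) :
    ∑ i ∈ range (N + 2), sinePolyDeriv N α (oddNode (N + 2) i) * cos (k * oddNode (N + 2) i)
      = ((N : ℝ) + 2) / 2 * ((if k ∈ Icc 1 N then k * α k else 0)
        - (N + 2 - k) * ∑ j ∈ Icc 1 N, if j + k = N + 2 then α j else 0) := by
  simp_rw [sinePolyDeriv, Finset.sum_mul]
  rw [Finset.sum_comm]
  have : ∀ j ∈ Icc 1 N, ∑ i ∈ range (N + 2),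
      α j * (j * cos (j * oddNode (N + 2) i)) * cos (k * oddNode (N + 2) i)
      = ((N : ℝ) + 2) / 2 * ((if j = k then j * α j else 0)
        - (N + 2 - k) * if j + k = N + 2 then α j else 0) := by
    intro j hj
    have hj' := Finset.mem_Icc.1 hj
    simp_rw [mul_assoc]
    rw [← Finset.mul_sum, ← Finset.mul_sum,
      sum_cos_mul_cos_oddNode (by omega) (by omega) (by omega)]
    push_cast
    split_ifs with h1 h2 h2
    · have : (j : ℝ) + k = N + 2 := by exact_mod_cast h2
      rw [← this]; ring
    · ring
    · have : (j : ℝ) + k = N + 2 := by exact_mod_cast h2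
      rw [← this]; ring
    · ring
  rw [Finset.sum_congr rfl this, ← Finset.mul_sum, Finset.sum_sub_distrib, ← Finset.mul_sum,
    Finset.sum_ite_eq' (Icc 1 N) k (fun j => (j : ℝ) * α j)]

theorem oddNode_zero_mem (m : ℕ) : 0 < oddNode (2 * m + 3) 0 ∧ oddNode (2 * m + 3) 0 < π := by
  refine ⟨oddNode_pos (by omega) 0, ?_⟩
  rw [← oddNode_middle m]
  exact oddNode_strictMono (by omega) (by omega)

/-- Only `t_0`, `π` and `2π - t_0` survive in the node sums, leaving three unknowns `S(t_0)`,
`S'(t_0)`, `S'(π)`. Frequencies `0` and `1` have no alias in range, so they fix the unknowns; the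
sine and cosine relations at `k` then form a linear system for `α_k` and `α_{M-k}`. -/
theorem coeff_eq_of_vanishing {m : ℕ} {α : ℕ → ℝ} (h1 : α 1 = 1)
    (hS : ∀ i ∈ Icc 1 m, sinePoly (2 * m + 1) α (oddNode (2 * m + 3) i) = 0)
    (hD : ∀ i ∈ Icc 1 m, sinePolyDeriv (2 * m + 1) α (oddNode (2 * m + 3) i) = 0)
    {k : ℕ} (hk : k ∈ Icc 1 (2 * m + 1)) :
    (2 * (m : ℝ) + 3) * α k
      = (2 * m + 3 - k) * sin (k * oddNode (2 * m + 3) 0) / sin (oddNode (2 * m + 3) 0)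
        + (cos (k * oddNode (2 * m + 3) 0) - (-1) ^ k) / (1 + cos (oddNode (2 * m + 3) 0)) := by
  have hd := oddNode_zero_mem m
  have hlast : oddNode (2 * m + 3) (2 * m + 2) = 2 * π - oddNode (2 * m + 3) 0 :=
    oddNode_reflect (M := 2 * m + 3) (i := 0) (by omega)
  have hmid := oddNode_middle m
  have hsum : ∀ f : ℕ → ℝ, (∀ i ∈ Icc 1 m, f i = 0) → (∀ i ∈ Icc 1 m, f (2 * m + 2 - i) = 0) →
      ∑ i ∈ range (2 * m + 3), f i = f 0 + f (m + 1) + f (2 * m + 2) := by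
    intro f hf hf'
    rw [Finset.sum_range_succ, Finset.sum_range_succ']
    have hz : ∀ i ∈ range (2 * m + 1), i ≠ m → f (i + 1) = 0 := by
      intro i hi him
      rw [Finset.mem_range] at hi
      rcases lt_or_gt_of_ne him with h | h
      · exact hf _ (Finset.mem_Icc.2 ⟨by omega, by omega⟩)
      · have := hf' (2 * m + 1 - i) (Finset.mem_Icc.2 ⟨by omega, by omega⟩)
        rwa [show 2 * m + 2 - (2 * m + 1 - i) = i + 1 by omega] at this
    rw [Finset.sum_eq_single_of_mem m (Finset.mem_range.2 (by omega)) hz]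
    ring
  have hrefl : ∀ i ∈ Icc 1 m,
      oddNode (2 * m + 3) (2 * m + 2 - i) = 2 * π - oddNode (2 * m + 3) i := by
    intro i hi
    have := Finset.mem_Icc.1 hi
    exact oddNode_reflect (M := 2 * m + 3) (i := i) (by omega)
  set d := oddNode (2 * m + 3) 0 with hd_def
  set S := sinePoly (2 * m + 1) α d with hS_def
  set D := sinePolyDeriv (2 * m + 1) α d with hD_def
  set D' := sinePolyDeriv (2 * m + 1) α π with hD'_def
  set s : ℕ → ℝ := fun k => ∑ j ∈ Icc 1 (2 * m + 1), if j + k = 2 * m + 3 then α j else 0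
    with hs_def
  have hA : ∀ k ∈ Icc 1 (2 * m + 1),
      2 * S * sin (k * d) = (2 * (m : ℝ) + 3) / 2 * (α k + s k) := by
    intro k hk
    have h := sum_sinePoly_mul_sin α hk
    rw [show 2 * m + 1 + 2 = 2 * m + 3 from rfl, hsum _ (fun i hi => by rw [hS i hi, zero_mul])
      (fun i hi => by rw [hrefl i hi, sinePoly_reflect, hS i hi, neg_zero, zero_mul]), hlast,
      sinePoly_reflect, hmid, sinePoly_pi, mul_sub, sin_nat_mul_two_pi_sub] at h
    push_cast at h
    linear_combination h
  have hB : ∀ k ≤ 2 * m + 1, 2 * D * cos (k * d) + D' * (-1) ^ k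
      = (2 * (m : ℝ) + 3) / 2 * ((if k ∈ Icc 1 (2 * m + 1) then k * α k else 0)
        - (2 * m + 3 - k) * s k) := by
    intro k hk
    have h := sum_sinePolyDeriv_mul_cos α hk
    rw [show 2 * m + 1 + 2 = 2 * m + 3 from rfl, hsum _ (fun i hi => by rw [hD i hi, zero_mul])
      (fun i hi => by rw [hrefl i hi, sinePolyDeriv_reflect, hD i hi, zero_mul]), hlast,
      sinePolyDeriv_reflect, hmid, mul_sub, cos_nat_mul_two_pi_sub, cos_nat_mul_pi] at h
    push_cast at h
    linear_combination h
  have hs0 : ∀ k ≤ 1, s k = 0 := by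
    intro k hk
    refine Finset.sum_eq_zero fun j hj => if_neg ?_
    have := Finset.mem_Icc.1 hj
    omega
  have hA1 := hA 1 (Finset.mem_Icc.2 ⟨le_rfl, by omega⟩)
  have hB0 := hB 0 (by omega)
  have hB1 := hB 1 (by omega)
  have hAk := hA k hk
  have hBk := hB k (Finset.mem_Icc.1 hk).2
  rw [if_pos hk] at hBk
  rw [if_pos (Finset.mem_Icc.2 ⟨le_rfl, by omega⟩), hs0 1 le_rfl, h1] at hB1
  rw [hs0 1 le_rfl, h1] at hA1
  rw [if_neg (by simp), hs0 0 (by omega)] at hB0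
  simp only [Nat.cast_one, one_mul, Nat.cast_zero, zero_mul, cos_zero, pow_zero, pow_one] at hA1 hB0 hB1
  have hsin : 0 < sin d := sin_pos_of_pos_of_lt_pi hd.1 hd.2
  have hcos : 0 < 1 + cos d := by
    have := cos_lt_cos_of_nonneg_of_le_pi hd.1.le le_rfl hd.2
    rw [cos_pi] at this
    linarith
  have hM : (2 * (m : ℝ) + 3) ≠ 0 := by positivity
  have eS : 2 * S = (2 * (m : ℝ) + 3) / 2 / sin d := by
    rw [eq_div_iff hsin.ne']; linarith
  have eD : 2 * D = (2 * (m : ℝ) + 3) / 2 / (1 + cos d) := by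
    rw [eq_div_iff hcos.ne']; linarith
  have eD' : D' = -(2 * D) := by linarith
  rw [eD', eD] at hBk
  rw [eS] at hAk
  have h2M : (2 * (m : ℝ) + 3) / 2 ≠ 0 := by positivity
  apply mul_left_cancel₀ h2M
  -- Weighting the sine relation by `M - k` eliminates the aliased coefficient and leaves `(M - k)
  -- α_k + k α_k = M α_k`.
  linear_combination (-(2 * (m : ℝ) + 3 - k)) * hAk - hBk

/-! ### The quadrature formula and the upper bound. -/

theorem sum_cot_mul_sinePoly (N : ℕ) (α : ℕ → ℝ) :
    ∑ i ∈ range (N + 2), cos (oddNode (N + 2) i / 2) / sin (oddNode (N + 2) i / 2)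
        * sinePoly N α (oddNode (N + 2) i)
      = ((N : ℝ) + 2) * ∑ j ∈ Icc 1 N, α j := by
  simp_rw [sinePoly, Finset.mul_sum]
  rw [Finset.sum_comm]
  refine Finset.sum_congr rfl fun j hj => ?_
  have hj' := Finset.mem_Icc.1 hj
  simp_rw [mul_left_comm _ (α j)]
  rw [← Finset.mul_sum, sum_cot_mul_sin_oddNode (by omega) (by omega)]
  push_cast; ring

theorem sum_sinePoly_mul_sin_one {N : ℕ} (hN : 1 ≤ N) (α : ℕ → ℝ) :
    ∑ i ∈ range (N + 2), sinePoly N α (oddNode (N + 2) i) * sin (oddNode (N + 2) i)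
      = ((N : ℝ) + 2) / 2 * α 1 := by
  have h := sum_sinePoly_mul_sin α (Finset.mem_Icc.2 ⟨le_rfl, hN⟩)
  rw [Finset.sum_eq_zero (s := Icc 1 N) (fun j hj => if_neg (by
    have := Finset.mem_Icc.1 hj
    omega))] at h
  simpa using h

theorem sin_half_oddNode_lt {M i : ℕ} (h0 : 0 < i) (hi : i < M - 1) :
    sin (oddNode M 0 / 2) < sin (oddNode M i / 2) := by
  have hM : 0 < M := by omega
  have hlt := oddNode_strictMono hM h0
  have hpos := oddNode_pos hM 0
  rcases le_total (oddNode M i) π with h | h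
  · exact sin_lt_sin_of_lt_of_le_pi_div_two (by linarith [pi_pos]) (by linarith) (by linarith)
  · have hlt' := oddNode_strictMono hM (show 0 < M - 1 - i by omega)
    rw [oddNode_reflect (by omega)] at hlt'
    rw [← sin_pi_sub (oddNode M i / 2)]
    exact sin_lt_sin_of_lt_of_le_pi_div_two (by linarith [pi_pos]) (by linarith) (by linarith)

/-- The maximal value of the sum of the coefficients for degree `2 * m + 1`. -/
noncomputable def extremalValue (m : ℕ) : ℝ := 1 / (4 * sin (oddNode (2 * m + 3) 0 / 2) ^ 2)

/-- The weight at the point `t` of the quadrature formula for the defect from the maximal value. -/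
noncomputable def defectWeight (m : ℕ) (t : ℝ) : ℝ :=
  2 * extremalValue m * sin t - cos (t / 2) / sin (t / 2)

theorem sum_defectWeight_mul_sinePoly (m : ℕ) (α : ℕ → ℝ) :
    ∑ i ∈ range (2 * m + 3), defectWeight m (oddNode (2 * m + 3) i)
        * sinePoly (2 * m + 1) α (oddNode (2 * m + 3) i)
      = (2 * m + 3) * (extremalValue m * α 1 - ∑ j ∈ Icc 1 (2 * m + 1), α j) := by
  have h1 := sum_cot_mul_sinePoly (2 * m + 1) α
  have h2 := sum_sinePoly_mul_sin_one (N := 2 * m + 1) (by omega) α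
  rw [show 2 * m + 1 + 2 = 2 * m + 3 from rfl] at h1 h2
  push_cast at h1 h2
  simp_rw [defectWeight, sub_mul]
  rw [Finset.sum_sub_distrib, h1]
  simp_rw [mul_assoc, mul_comm (sin (oddNode _ _)) (sinePoly _ _ _)]
  rw [← Finset.mul_sum, ← Finset.mul_sum, h2]
  ring

theorem defectWeight_reflect (m : ℕ) (t : ℝ) : defectWeight m (2 * π - t) = -defectWeight m t := by
  unfold defectWeight
  rw [show (2 * π - t) / 2 = π - t / 2 by ring, sin_two_pi_sub, sin_pi_sub, cos_pi_sub]
  ring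

/-- In this factored form the choice of `extremalValue` is visible: the weight vanishes at the first
node, and its sign at later nodes below `π` is that of a difference of squared sines. -/
theorem defectWeight_oddNode (m : ℕ) {i : ℕ} (hi : i < 2 * m + 3) :
    defectWeight m (oddNode (2 * m + 3) i)
      = cos (oddNode (2 * m + 3) i / 2)
        * (sin (oddNode (2 * m + 3) i / 2) ^ 2 - sin (oddNode (2 * m + 3) 0 / 2) ^ 2)
        / (sin (oddNode (2 * m + 3) i / 2) * sin (oddNode (2 * m + 3) 0 / 2) ^ 2) := by
  have h1 := (sin_half_oddNode_pos hi).ne'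
  have h0 := (sin_half_oddNode_pos (M := 2 * m + 3) (i := 0) (by omega)).ne'
  unfold defectWeight extremalValue
  have : sin (oddNode (2 * m + 3) i)
      = 2 * sin (oddNode (2 * m + 3) i / 2) * cos (oddNode (2 * m + 3) i / 2) := by
    rw [← sin_two_mul]; congr 1; ring
  rw [this]
  field_simp
  ring

theorem defectWeight_oddNode_zero (m : ℕ) : defectWeight m (oddNode (2 * m + 3) 0) = 0 := by
  rw [defectWeight_oddNode m (by omega)]; simp

theorem oddNode_mem_Ioo {m i : ℕ} (hi : i ∈ Icc 1 m) :
    oddNode (2 * m + 3) i ∈ Set.Ioo 0 π := by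
  have := Finset.mem_Icc.1 hi
  refine ⟨oddNode_pos (by omega) i, ?_⟩
  rw [← oddNode_middle m]
  exact oddNode_strictMono (by omega) (by omega)

theorem defectWeight_oddNode_pos {m i : ℕ} (hi : i ∈ Icc 1 m) :
    0 < defectWeight m (oddNode (2 * m + 3) i) := by
  have hi' := Finset.mem_Icc.1 hi
  have ht := oddNode_mem_Ioo hi
  rw [defectWeight_oddNode m (by omega)]
  have h0 := sin_half_oddNode_pos (M := 2 * m + 3) (i := 0) (by omega)
  have hlt := sin_half_oddNode_lt (M := 2 * m + 3) (i := i) (by omega) (by omega)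
  have hc : 0 < cos (oddNode (2 * m + 3) i / 2) :=
    cos_pos_of_mem_Ioo ⟨by linarith [ht.1, pi_pos], by linarith [ht.2]⟩
  have h1 := h0.trans hlt
  have : 0 < sin (oddNode (2 * m + 3) i / 2) ^ 2 - sin (oddNode (2 * m + 3) 0 / 2) ^ 2 := by
    have := pow_lt_pow_left₀ hlt h0.le two_ne_zero
    linarith
  positivity

/-- The reflection `t ↦ 2π - t` reduces statements about all nodes to the first half of them. -/
theorem oddNode_induction {m : ℕ} {p : ℝ → Prop} (hp : ∀ t, p t → p (2 * π - t))
    (h0 : p (oddNode (2 * m + 3) 0)) (h1 : ∀ i ∈ Icc 1 m, p (oddNode (2 * m + 3) i)) (hπ : p π)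
    {i : ℕ} (hi : i < 2 * m + 3) : p (oddNode (2 * m + 3) i) := by
  have half : ∀ i ≤ m + 1, p (oddNode (2 * m + 3) i) := by
    intro i hi
    rcases Nat.eq_zero_or_pos i with rfl | h
    · exact h0
    · rcases hi.eq_or_lt with rfl | h'
      · rwa [oddNode_middle]
      · exact h1 i (Finset.mem_Icc.2 ⟨h, by omega⟩)
  rcases le_total i (m + 1) with h | h
  · exact half i h
  · have := hp _ (half (2 * m + 3 - 1 - i) (by omega))
    rwa [oddNode_reflect hi, sub_sub_cancel] at this

theorem defectWeight_mul_sinePoly_nonneg {m : ℕ} {α : ℕ → ℝ}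
    (hα : ∀ t ∈ Set.Icc (0 : ℝ) π, 0 ≤ sinePoly (2 * m + 1) α t) {i : ℕ} (hi : i < 2 * m + 3) :
    0 ≤ defectWeight m (oddNode (2 * m + 3) i)
      * sinePoly (2 * m + 1) α (oddNode (2 * m + 3) i) := by
  refine oddNode_induction (p := fun t => 0 ≤ defectWeight m t * sinePoly (2 * m + 1) α t)
    ?_ ?_ ?_ ?_ hi
  · intro t ht
    rw [defectWeight_reflect, sinePoly_reflect]
    linarith
  · rw [defectWeight_oddNode_zero, zero_mul]
  · intro i hi
    have := oddNode_mem_Ioo hi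
    exact mul_nonneg (defectWeight_oddNode_pos hi).le (hα _ ⟨this.1.le, this.2.le⟩)
  · rw [sinePoly_pi, mul_zero]

theorem sum_coeff_le {m : ℕ} {α : ℕ → ℝ} (hα : α ∈ admissibleCoeffs (2 * m + 1)) :
    ∑ j ∈ Icc 1 (2 * m + 1), α j ≤ extremalValue m := by
  have h := sum_defectWeight_mul_sinePoly m α
  have h0 := Finset.sum_nonneg fun i hi =>
    defectWeight_mul_sinePoly_nonneg hα.2 (Finset.mem_range.1 hi)
  rw [h, hα.1, mul_one] at h0
  exact sub_nonneg.1 (nonneg_of_mul_nonneg_right h0 (by positivity))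

/-- The defect is a sum of nonnegative terms, so it is zero only if each term is; the weights at
`t_1, …, t_m` are nonzero. -/
theorem sum_coeff_eq_iff {m : ℕ} {α : ℕ → ℝ} (hα : α ∈ admissibleCoeffs (2 * m + 1)) :
    ∑ j ∈ Icc 1 (2 * m + 1), α j = extremalValue m ↔
      ∀ i ∈ Icc 1 m, sinePoly (2 * m + 1) α (oddNode (2 * m + 3) i) = 0 := by
  have h := sum_defectWeight_mul_sinePoly m α
  rw [hα.1, mul_one] at h
  constructor
  · intro he i hi
    rw [he, sub_self, mul_zero, Finset.sum_eq_zero_iff_of_nonneg fun i hi =>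
      defectWeight_mul_sinePoly_nonneg hα.2 (Finset.mem_range.1 hi)] at h
    have := h i (Finset.mem_range.2 (by have := Finset.mem_Icc.1 hi; omega))
    exact (mul_eq_zero.1 this).resolve_left (defectWeight_oddNode_pos hi).ne'
  · intro hz
    rw [Finset.sum_eq_zero] at h
    · have hM : (2 * (m : ℝ) + 3) ≠ 0 := by positivity
      have := (mul_eq_zero.1 h.symm).resolve_left hM
      linarith
    · intro i hi
      refine oddNode_induction (p := fun t => defectWeight m t * sinePoly (2 * m + 1) α t = 0)
        ?_ ?_ ?_ ?_ (Finset.mem_range.1 hi)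
      · intro t ht
        rw [defectWeight_reflect, sinePoly_reflect, neg_mul_neg, ht]
      · rw [defectWeight_oddNode_zero, zero_mul]
      · intro i hi
        rw [hz i hi, mul_zero]
      · rw [sinePoly_pi, mul_zero]

/-! ### Existence of an admissible polynomial with the required zeros. -/

/-- The space of sine polynomials of degree at most `n`. -/
noncomputable def sineSpan (n : ℕ) : Submodule ℝ (ℝ → ℝ) :=
  Submodule.span ℝ ((fun (j : ℕ) (t : ℝ) => sin (j * t)) '' (Icc 1 n : Finset ℕ))

theorem mem_sineSpan_iff {n : ℕ} {f : ℝ → ℝ} : f ∈ sineSpan n ↔ ∃ β, sinePoly n β = f := by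
  unfold sineSpan
  rw [Submodule.mem_span_image_finset_iff_exists_fun']
  refine exists_congr fun β => ?_
  have : ∑ i ∈ Icc 1 n, β i • (fun t : ℝ => sin ((i : ℝ) * t)) = sinePoly n β := by
    ext t; simp [sinePoly]
  rw [this]

theorem sin_mem_sineSpan {n j : ℕ} (hj : j ≤ n) : (fun t : ℝ => sin (j * t)) ∈ sineSpan n := by
  rcases Nat.eq_zero_or_pos j with rfl | h
  · have : (fun t : ℝ => sin ((0 : ℕ) * t)) = 0 := by ext t; simp
    rw [this]
    exact Submodule.zero_mem _
  · exact Submodule.subset_span ⟨j, by simp; omega, rfl⟩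

theorem cos_sub_mul_mem_sineSpan {n : ℕ} (c : ℝ) {f : ℝ → ℝ} (hf : f ∈ sineSpan n) :
    (fun t => (cos t - c) * f t) ∈ sineSpan (n + 1) := by
  induction hf using Submodule.span_induction with
  | mem f hf =>
    obtain ⟨j, hj, rfl⟩ := hf
    have hj' := Finset.mem_Icc.1 (Finset.mem_coe.1 hj)
    -- Product-to-sum formula; for `j = 1` the lower frequency is `0` and its term vanishes.
    have : (fun t : ℝ => (cos t - c) * sin (j * t))
        = (1 / 2 : ℝ) • (fun t : ℝ => sin ((j + 1 : ℕ) * t))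
          + (1 / 2 : ℝ) • (fun t : ℝ => sin ((j - 1 : ℕ) * t))
          + (-c) • (fun t : ℝ => sin (j * t)) := by
      ext t
      simp only [Pi.add_apply, Pi.smul_apply, smul_eq_mul]
      rw [Nat.cast_sub hj'.1]
      push_cast
      rw [add_mul, sub_mul (j : ℝ), one_mul, sin_add, sin_sub]
      ring
    rw [this]
    exact Submodule.add_mem _ (Submodule.add_mem _
      (Submodule.smul_mem _ _ (sin_mem_sineSpan (by omega)))
      (Submodule.smul_mem _ _ (sin_mem_sineSpan (by omega))))
      (Submodule.smul_mem _ _ (sin_mem_sineSpan (by omega)))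
  | zero =>
    have : (fun t : ℝ => (cos t - c) * (0 : ℝ → ℝ) t) = 0 := by ext t; simp
    rw [this]
    exact Submodule.zero_mem _
  | add f g _ _ hf hg =>
    have : (fun t : ℝ => (cos t - c) * (f + g) t)
        = (fun t => (cos t - c) * f t) + fun t => (cos t - c) * g t := by
      ext t; simp only [Pi.add_apply]; ring
    rw [this]
    exact Submodule.add_mem _ hf hg
  | smul a f _ hf =>
    have : (fun t : ℝ => (cos t - c) * (a • f) t) = a • fun t => (cos t - c) * f t := by
      ext t; simp only [Pi.smul_apply, smul_eq_mul]; ring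
    rw [this]
    exact Submodule.smul_mem _ _ hf

theorem sin_mul_prod_mem_sineSpan (s : Finset ℕ) (c : ℕ → ℝ) :
    (fun t => sin t * ∏ i ∈ s, (cos t - c i) ^ 2) ∈ sineSpan (2 * s.card + 1) := by
  classical
  induction s using Finset.induction_on with
  | empty => simpa using sin_mem_sineSpan (n := 1) (j := 1) le_rfl
  | insert a s ha ih =>
    rw [Finset.card_insert_of_notMem ha]
    have := cos_sub_mul_mem_sineSpan (c a) (cos_sub_mul_mem_sineSpan (c a) ih)
    rw [show 2 * (s.card + 1) + 1 = 2 * s.card + 1 + 1 + 1 by ring]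
    convert this using 2
    rw [Finset.prod_insert ha]; ring

theorem sinePoly_const_mul (N : ℕ) (c : ℝ) (α : ℕ → ℝ) (t : ℝ) :
    sinePoly N (fun j => c * α j) t = c * sinePoly N α t := by
  simp only [sinePoly, Finset.mul_sum, mul_assoc]

theorem exists_admissible_vanishing (m : ℕ) :
    ∃ α ∈ admissibleCoeffs (2 * m + 1),
      ∀ i ∈ Icc 1 m, sinePoly (2 * m + 1) α (oddNode (2 * m + 3) i) = 0 := by
  have hmem := sin_mul_prod_mem_sineSpan (Icc 1 m) (fun i => cos (oddNode (2 * m + 3) i))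
  rw [Nat.card_Icc, Nat.add_sub_cancel, mem_sineSpan_iff] at hmem
  obtain ⟨β, hβ⟩ := hmem
  have hβ' := congrFun hβ
  have hsum := sum_sinePoly_mul_sin_one (N := 2 * m + 1) (by omega) β
  have hd := oddNode_zero_mem m
  -- This sum is a positive multiple of `β 1`, so its positivity permits the normalization: each
  -- term is `sin²` times squares, and the one at `t_0` is positive.
  have hpos : 0 < ∑ i ∈ range (2 * m + 1 + 2), sinePoly (2 * m + 1) β (oddNode (2 * m + 1 + 2) i)
      * sin (oddNode (2 * m + 1 + 2) i) := by
    refine Finset.sum_pos' (fun i _ => ?_) ⟨0, Finset.mem_range.2 (by omega), ?_⟩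
    · rw [hβ', mul_right_comm]
      exact mul_nonneg (mul_self_nonneg _) (Finset.prod_nonneg fun j _ => sq_nonneg _)
    · rw [hβ', mul_right_comm]
      have hs := sin_pos_of_pos_of_lt_pi hd.1 hd.2
      refine mul_pos (mul_pos hs hs) (Finset.prod_pos fun j hj => sq_pos_of_pos (sub_pos.2 ?_))
      exact cos_lt_cos_of_nonneg_of_le_pi hd.1.le (oddNode_mem_Ioo hj).2.le
        (oddNode_strictMono (by omega) (Finset.mem_Icc.1 hj).1)
  rw [hsum] at hpos
  have hβ1 : 0 < β 1 := pos_of_mul_pos_right hpos (by positivity)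
  refine ⟨fun j => (β 1)⁻¹ * β j, ⟨inv_mul_cancel₀ hβ1.ne', fun t ht => ?_⟩, fun i hi => ?_⟩
  · rw [sinePoly_const_mul, hβ']
    exact mul_nonneg (inv_nonneg.2 hβ1.le) (mul_nonneg (sin_nonneg_of_nonneg_of_le_pi ht.1 ht.2)
      (Finset.prod_nonneg fun j _ => sq_nonneg _))
  · rw [sinePoly_const_mul, hβ', Finset.prod_eq_zero hi (by simp), mul_zero, mul_zero]

/-! ### Characterization of the extremal polynomial and conclusion. -/

theorem isExtremalCoeffs_iff_vanishing {m : ℕ} {α : ℕ → ℝ} :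
    IsExtremalCoeffs (2 * m + 1) α ↔ α ∈ admissibleCoeffs (2 * m + 1) ∧
      ∀ i ∈ Icc 1 m, sinePoly (2 * m + 1) α (oddNode (2 * m + 3) i) = 0 := by
  refine and_congr_right fun hα => ?_
  rw [← sum_coeff_eq_iff hα]
  constructor
  · intro h
    obtain ⟨β, hβ, hz⟩ := exists_admissible_vanishing m
    have := h hβ
    simp only [Set.mem_ofPred_eq, (sum_coeff_eq_iff hβ).2 hz] at this
    exact le_antisymm (sum_coeff_le hα) this
  · intro h β hβ
    simp only [Set.mem_ofPred_eq, h]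
    exact sum_coeff_le hβ

theorem coeff_eq_explicitCoeff {m : ℕ} {α : ℕ → ℝ} (hα : α ∈ admissibleCoeffs (2 * m + 1))
    (hz : ∀ i ∈ Icc 1 m, sinePoly (2 * m + 1) α (oddNode (2 * m + 3) i) = 0)
    {k : ℕ} (hk : k ∈ Icc 1 (2 * m + 1)) : α k = explicitCoeff (2 * m + 1) k := by
  have hD : ∀ i ∈ Icc 1 m, sinePolyDeriv (2 * m + 1) α (oddNode (2 * m + 3) i) = 0 := by
    intro i hi
    have ht := oddNode_mem_Ioo hi
    -- An interior zero of a nonnegative function is a minimum, hence a critical point.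
    have hmin : IsLocalMin (sinePoly (2 * m + 1) α) (oddNode (2 * m + 3) i) := by
      filter_upwards [Icc_mem_nhds ht.1 ht.2] with t h
      rw [hz i hi]
      exact hα.2 t h
    exact hmin.hasDerivAt_eq_zero (hasDerivAt_sinePoly _ _ _)
  have hM : (2 * (m : ℝ) + 3) ≠ 0 := by positivity
  apply mul_left_cancel₀ hM
  rw [coeff_eq_of_vanishing hα.1 hz hD hk, explicitCoeff_eq m k (Finset.mem_Icc.1 hk).1]

theorem isExtremalCoeffs_congr {N : ℕ} (hN : 1 ≤ N) {α β : ℕ → ℝ}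
    (h : ∀ k ∈ Icc 1 N, α k = β k) (hβ : IsExtremalCoeffs N β) : IsExtremalCoeffs N α := by
  have hS : sinePoly N α = sinePoly N β := by
    ext t
    exact Finset.sum_congr rfl fun j hj => by rw [h j hj]
  refine ⟨⟨(h 1 (Finset.mem_Icc.2 ⟨le_rfl, hN⟩)).trans hβ.1.1, fun t ht => ?_⟩, fun γ hγ => ?_⟩
  · rw [hS]
    exact hβ.1.2 t ht
  · have := hβ.2 hγ
    simp only [Set.mem_ofPred_eq] at this ⊢
    rwa [Finset.sum_congr rfl h]

theorem theorem4p2 (N : ℕ) (hN : Odd N) :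
    (∀ α : ℕ → ℝ,
      IsExtremalCoeffs N α ↔ ∀ k ∈ Finset.Icc 1 N, α k = explicitCoeff N k) ∧
    (Polynomial.derivative (Polynomial.Chebyshev.U ℝ (N : ℤ))).eval
      (Real.sin (Real.pi / (2 * ((N : ℝ) + 2)))) ≠ 0 ∧
    ∀ k ∈ Finset.Icc 1 N, 0 < explicitCoeff N k := by
  obtain ⟨m, rfl⟩ := hN
  refine ⟨fun α => ⟨fun h k hk => ?_, fun h => ?_⟩, derivative_U_eval_sin_ne_zero m,
    fun k hk => explicitCoeff_pos m k hk⟩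
  · obtain ⟨h1, h2⟩ := isExtremalCoeffs_iff_vanishing.1 h
    exact coeff_eq_explicitCoeff h1 h2 hk
  -- Nonnegativity for the explicit coefficients needs no direct check: by uniqueness they agree
  -- with the polynomial constructed as a product.
  · obtain ⟨β, hβ, hz⟩ := exists_admissible_vanishing m
    refine isExtremalCoeffs_congr (by omega) (fun k hk => ?_)
      (isExtremalCoeffs_iff_vanishing.2 ⟨hβ, hz⟩)
    rw [h k hk, coeff_eq_explicitCoeff hβ hz hk]
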